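/- Let $H^2_{\mathbb R}(\mathbb D)$ be the real Hilbert space of functions $f(z)=\sum_{n\ge 0}a_nz^n$ on the open unit disc with real coefficients and $\sum a_n^2<\infty$, with inner product $\langle\sum a_nz^n,\sum b_nz^n\rangle=\sum a_nb_n$. Let $T_z f=zf$ be the shift and $T_z^*$ its adjoint, so that $(T_z^*f)(z)=(f(z)-f(0))/z$. "Subspace" means closed subspace. A defect space of a subspace $\mathcal M$ is a finite-dimensional subspace $\mathcal F$ of $H^2_{\mathbb R}(\mathbb D)$, orthogonal to $\mathcal M$, such that $T_z^*f\in\mathcal M\oplus\mathcal F$ whenever $f\in\mathcal M$ and $f(0)=0$, and of the smallest dimension among all such $\mathcal F$; this dimension is called the defect, and $\mathcal M$ is then called nearly $T_z^*$-invariant with that defect. **Theorem.** Let $\mathcal M$ be a non-zero subspace of $H^2_{\mathbb R}(\mathbb D)$ which is nearly $T_z^*$-invariant with defect $1$, and let the unit vector $e$ span a defect space of $\mathcal M$. (i) If some function in $\mathcal M$ does not vanish at $0$, then there is a unique function $g$ of unit norm in $\mathcal M$ which is orthogonal to $\mathcal M\cap zH^2_{\mathbb R}(\mathbb D)$ and satisfies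 $g(0)>0$, and there is a $(T_z^*\oplus T_z^*)$-invariant subspace $\mathcal N\subset H^2_{\mathbb R}(\mathbb D)\oplus H^2_{\mathbb R}(\mathbb D)$ such that $$\mathcal M=\{\,gh+zh_1e : (h,h_1)\in\mathcal N\,\},$$ and, whenever $f=gh+zh_1e\in\mathcal M$ with $(h,h_1)\in\mathcal N$, $$\|f\|^2=\|h\|^2+\|h_1\|^2 .$$ (ii) If all functions in $\mathcal M$ vanish at $0$, then there is a $T_z^*$-invariant subspace $\mathcal N\subset H^2_{\mathbb R}(\mathbb D)$ such that $$\mathcal M=\{\,zh_1e : h_1\in\mathcal N\,\},$$ and $\|f\|=\|h_1\|$ whenever $f=zh_1e\in\mathcal M$ with $h_1\in\mathcal N$. -/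

import Mathlib

open scoped ComplexOrder InnerProductSpace Complex.UnitDisc

/-- The real Hardy space of the unit disc: power series `∑ aₙ zⁿ` with real square-summable
coefficients, with the real Hilbert space structure `⟪∑ aₙ zⁿ, ∑ bₙ zⁿ⟫ = ∑ aₙ bₙ`.
An element is stored as its coefficient sequence; the function on the disc which it represents is
`RealHardy.toFun`, and `RealHardy.toFun_injective` shows that nothing is lost. -/
abbrev RealHardy : Type := lp (fun _ : ℕ => ℝ) 2

namespace RealHardy

/-- The function `z ↦ ∑ aₙ zⁿ` on the open unit disc. -/
noncomputable def toFun (f : RealHardy) : 𝔻 → ℂ :=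
  fun z => ∑' n : ℕ, ((f n : ℝ) : ℂ) * (z : ℂ) ^ n

theorem summable_toFun (f : RealHardy) (z : 𝔻) :
    Summable fun n : ℕ => ((f n : ℝ) : ℂ) * (z : ℂ) ^ n := by
  refine Summable.of_norm_bounded
    (g := fun n : ℕ => ‖f‖ * ‖(z : ℂ)‖ ^ n) ?_ ?_
  · exact (summable_geometric_of_lt_one (norm_nonneg _) z.norm_lt_one).mul_left _
  · intro n
    rw [norm_mul, norm_pow, Complex.norm_real]
    exact mul_le_mul_of_nonneg_right (lp.norm_apply_le_norm (by norm_num) f n) (by positivity)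

theorem hasSum_toFun (f : RealHardy) (z : 𝔻) :
    HasSum (fun n : ℕ => ((f n : ℝ) : ℂ) * (z : ℂ) ^ n) (toFun f z) :=
  (summable_toFun f z).hasSum

theorem toFun_zero (f : RealHardy) : toFun f 0 = ((f 0 : ℝ) : ℂ) := by
  unfold toFun
  rw [tsum_eq_single 0]
  · simp
  · intro n hn
    simp [hn]

/-- An element of the real Hardy space is determined by its function on the disc. -/
theorem toFun_injective : Function.Injective toFun := by
  intro f g hfg
  have key : ∀ f : RealHardy, HasFPowerSeriesOnBall
      (fun z : ℂ => ∑' n : ℕ, ((f n : ℝ) : ℂ) * z ^ n)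
      (FormalMultilinearSeries.ofScalars ℂ (fun n : ℕ => ((f n : ℝ) : ℂ))) 0 1 := by
    intro f
    refine ⟨?_, by norm_num, ?_⟩
    · refine ENNReal.le_of_forall_nnreal_lt fun r hr => ?_
      refine FormalMultilinearSeries.le_radius_of_bound _ ‖f‖ fun n => ?_
      have hr' : (r : ℝ) < 1 := by exact_mod_cast hr
      rw [FormalMultilinearSeries.ofScalars_norm, Complex.norm_real]
      calc ‖f n‖ * (r : ℝ) ^ n ≤ ‖f‖ * 1 := by
            gcongr
            · exact lp.norm_apply_le_norm (by norm_num) f n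
            · exact pow_le_one₀ r.2 hr'.le
        _ = ‖f‖ := mul_one _
    · intro y hy
      have hy' : ‖y‖ < 1 := by
        have hy2 : ‖y‖ₑ < 1 := by simpa using hy
        simpa [← ofReal_norm] using hy2
      have h := hasSum_toFun f (Complex.UnitDisc.mk y hy')
      simpa [FormalMultilinearSeries.ofScalars_apply_eq, toFun, smul_eq_mul, mul_comm] using h
  have h1 := (key f).hasFPowerSeriesAt
  have h2 := (key g).hasFPowerSeriesAt
  have hev : (fun z : ℂ => ∑' n : ℕ, ((f n : ℝ) : ℂ) * z ^ n) =ᶠ[nhds 0]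
      (fun z : ℂ => ∑' n : ℕ, ((g n : ℝ) : ℂ) * z ^ n) := by
    filter_upwards [Metric.ball_mem_nhds (0 : ℂ) one_pos] with z hz
    have hz' : ‖z‖ < 1 := by simpa using hz
    simpa [toFun] using congrFun hfg (Complex.UnitDisc.mk z hz')
  have h3 := h1.eq_formalMultilinearSeries (h2.congr hev.symm)
  ext n
  have h4 := congrArg (fun p => FormalMultilinearSeries.coeff p n) h3
  simpa [FormalMultilinearSeries.coeff_ofScalars] using h4

/-- The coefficients of `z f(z)`. -/
def shiftSeq (a : ℕ → ℝ) : ℕ → ℝ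
  | 0 => 0
  | n + 1 => a n

theorem memℓp_shiftSeq (f : RealHardy) : Memℓp (shiftSeq fun n => f n) 2 := by
  have h := lp.memℓp f
  rw [memℓp_gen_iff (by norm_num)] at h ⊢
  exact (summable_nat_add_iff 1).mp (by simpa [shiftSeq] using h)

theorem norm_shiftSeq (f : RealHardy) :
    ‖(⟨shiftSeq fun n => f n, memℓp_shiftSeq f⟩ : RealHardy)‖ = ‖f‖ := by
  have hp : 0 < (2 : ENNReal).toReal := by norm_num
  have hs := (memℓp_gen_iff (E := fun _ : ℕ => ℝ) hp).mp (memℓp_shiftSeq f)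
  rw [lp.norm_eq_tsum_rpow hp, lp.norm_eq_tsum_rpow hp]
  congr 1
  change ∑' n, ‖shiftSeq (fun n => f n) n‖ ^ (2 : ENNReal).toReal = _
  rw [hs.tsum_eq_zero_add]
  simp [shiftSeq]

/-- The shift operator `(T_z f)(z) = z f(z)`. -/
noncomputable def shift : RealHardy →L[ℝ] RealHardy :=
  LinearMap.mkContinuous
    { toFun := fun f => ⟨shiftSeq fun n => f n, memℓp_shiftSeq f⟩
      map_add' := fun f g => by
        ext n
        cases n with
        | zero => exact (add_zero (0 : ℝ)).symm
        | succ n => rfl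
      map_smul' := fun c f => by
        ext n
        cases n <;> simp [shiftSeq] }
    1 (fun f => by
      rw [one_mul]
      exact (norm_shiftSeq f).le)

theorem shift_apply_zero (f : RealHardy) : shift f 0 = 0 := rfl

theorem shift_apply_succ (f : RealHardy) (n : ℕ) : shift f (n + 1) = f n := rfl

/-- The backward shift operator `T_z^*`, the adjoint of the shift. -/
noncomputable def backwardShift : RealHardy →L[ℝ] RealHardy :=
  ContinuousLinearMap.adjoint shift

theorem backwardShift_apply (f : RealHardy) (n : ℕ) : backwardShift f n = f (n + 1) := by
  have h := ContinuousLinearMap.adjoint_inner_right shift (lp.single 2 n (1 : ℝ)) f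
  have hs : shift (lp.single 2 n (1 : ℝ)) = lp.single 2 (n + 1) (1 : ℝ) := by
    ext k
    cases k with
    | zero => simp [shift_apply_zero, lp.single_apply]
    | succ k => simp [shift_apply_succ, lp.single_apply, Pi.single_apply]
  rw [hs, lp.inner_single_left, lp.inner_single_left] at h
  simpa [backwardShift] using h

theorem toFun_shift (f : RealHardy) (z : 𝔻) : toFun (shift f) z = z * toFun f z := by
  rw [toFun, (summable_toFun (shift f) z).tsum_eq_zero_add, toFun, ← tsum_mul_left]
  simp only [shift_apply_zero, shift_apply_succ, Complex.ofReal_zero, zero_mul, zero_add]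
  exact tsum_congr fun n => by ring

/-- `(T_z^* f)(z) = (f(z) - f(0)) / z`. -/
theorem toFun_backwardShift (f : RealHardy) (z : 𝔻) (hz : (z : ℂ) ≠ 0) :
    toFun (backwardShift f) z = (toFun f z - toFun f 0) / z := by
  rw [eq_div_iff hz, toFun_zero, eq_sub_iff_add_eq, toFun, toFun,
    (summable_toFun f z).tsum_eq_zero_add, ← tsum_mul_right, add_comm]
  simp only [backwardShift_apply, pow_zero, mul_one]
  congr 1
  exact tsum_congr fun n => by ring

/-- `F` is a finite dimensional subspace orthogonal to `M` such that `T_z^* f ∈ M ⊕ F` whenever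
`f ∈ M` and `f(0) = 0`. -/
def AdmitsDefect (M F : Submodule ℝ RealHardy) : Prop :=
  FiniteDimensional ℝ F ∧ M ⟂ F ∧ ∀ f ∈ M, toFun f 0 = 0 → backwardShift f ∈ M ⊔ F

/-- `F` is a defect space of `M`: it is of the smallest dimension among the finite dimensional
subspaces as in `AdmitsDefect`. -/
def IsDefectSpace (M F : Submodule ℝ RealHardy) : Prop :=
  AdmitsDefect M F ∧
    ∀ F' : Submodule ℝ RealHardy, AdmitsDefect M F' → Module.finrank ℝ F ≤ Module.finrank ℝ F'

/-- `M` is nearly `T_z^*`-invariant with defect `n`. -/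
def IsNearlyInvariantWithDefect (M : Submodule ℝ RealHardy) (n : ℕ) : Prop :=
  ∃ F : Submodule ℝ RealHardy, IsDefectSpace M F ∧ Module.finrank ℝ F = n

/-- `g` is a function of unit norm in `M`, orthogonal to `M ∩ z H²_ℝ`, with `g(0) > 0` (in `ℂ`,
so that `g(0)` is real and positive). A function of `H²_ℝ` lies in `z H²_ℝ` when it is in the
range of the shift. -/
def IsNormalizedGenerator (M : Submodule ℝ RealHardy) (g : RealHardy) : Prop :=
  g ∈ M ∧ ‖g‖ = 1 ∧ (∀ f ∈ M ⊓ LinearMap.range shift.toLinearMap, ⟪g, f⟫_ℝ = 0) ∧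
    (0 : ℂ) < toFun g 0

end RealHardy

namespace RealHardy

/-! Write `S`, `B` for the shift and its adjoint, and put `q = S e`. For `f ∈ M`, remove the `g`
component, then the `q` component, then apply `B`. The result `A f` is again in `M`: the first
removal kills the value at `0`, and the second removes exactly the `e` component of the backward
shift. Iterating peels off coefficients `aₙ`, `bₙ` with `f = g ∑_{n<N} aₙzⁿ + q ∑_{n<N} bₙzⁿ + z^N
A^N f` and `‖f‖² = ∑_{n<N} (aₙ² + bₙ²) + ‖A^N f‖²`. The map `f ↦ (∑ aₙzⁿ, ∑ bₙzⁿ)` intertwines `A`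
with `B ⊕ B`, so its range is the required `N` as soon as `A^N f → 0`.

That limit is the real content (`tendsto_deflatedShift_pow`), and it holds for all unit vectors `g`,
`q`, orthogonal or not. By contractivity and density it suffices to treat a polynomial `f`. Feeding
`A` with inputs `uᵢ f` gives an energy estimate (`driven_energy`) showing that convolution with
`(aₙ)` and with `(bₙ)` is bounded on `ℓ²`. For large `n`, `A^n f = -∑_{k<n} B^{n-k}(aₖ g + bₖ q)`.
Replacing `g`, `q` by nearby polynomials makes this sum tend to `0`, since `aₖ, bₖ → 0`, while the
error is small in mean square over `n` by the convolution bound. So the norms cannot stay away from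
`0`.

Part (ii) is the same argument with `g = q`. -/

/-! ### Identities and estimates for the two shifts and for point evaluations. -/

theorem backwardShift_shift (f : RealHardy) : backwardShift (shift f) = f := by
  ext n
  rw [backwardShift_apply, shift_apply_succ]

theorem shift_backwardShift {f : RealHardy} (hf : f 0 = 0) : shift (backwardShift f) = f := by
  ext n
  cases n with
  | zero => rw [shift_apply_zero, hf]
  | succ n => rw [shift_apply_succ, backwardShift_apply]

theorem norm_shift (f : RealHardy) : ‖shift f‖ = ‖f‖ := norm_shiftSeq f

theorem inner_shift_left (f g : RealHardy) : ⟪shift f, g⟫_ℝ = ⟪f, backwardShift g⟫_ℝ :=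
  (ContinuousLinearMap.adjoint_inner_right shift f g).symm

theorem inner_shift_pow_left (n : ℕ) (f g : RealHardy) :
    ⟪(shift ^ n) f, g⟫_ℝ = ⟪f, (backwardShift ^ n) g⟫_ℝ := by
  induction n generalizing f g with
  | zero => rfl
  | succ n ih =>
    rw [pow_succ', pow_succ, mul_apply_eq_comp, mul_apply_eq_comp,
      inner_shift_left, ih]

theorem norm_shift_pow (n : ℕ) (f : RealHardy) : ‖(shift ^ n) f‖ = ‖f‖ := by
  induction n with
  | zero => rfl
  | succ n ih => rw [pow_succ', mul_apply_eq_comp, norm_shift, ih]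

theorem backwardShift_pow_apply (n m : ℕ) (f : RealHardy) :
    (backwardShift ^ n) f m = f (m + n) := by
  induction n generalizing m with
  | zero => rfl
  | succ n ih =>
    rw [pow_succ', mul_apply_eq_comp, backwardShift_apply, ih]
    rw [add_right_comm, add_assoc]

theorem backwardShift_pow_shift_pow (n : ℕ) (f : RealHardy) :
    (backwardShift ^ n) ((shift ^ n) f) = f := by
  induction n with
  | zero => rfl
  | succ n ih =>
    rw [pow_succ, pow_succ', mul_apply_eq_comp, mul_apply_eq_comp,
      backwardShift_shift, ih]

theorem hasSum_sq (f : RealHardy) : HasSum (fun n => f n ^ 2) (‖f‖ ^ 2) := by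
  have h := lp.hasSum_norm (p := 2) (by norm_num) f
  simpa using h

theorem norm_backwardShift_sq (f : RealHardy) :
    ‖backwardShift f‖ ^ 2 = ‖f‖ ^ 2 - f 0 ^ 2 := by
  have h := (hasSum_nat_add_iff' 1).mpr (hasSum_sq f)
  have h' := hasSum_sq (backwardShift f)
  simp only [backwardShift_apply] at h'
  simpa using h'.unique h

theorem norm_backwardShift_le (f : RealHardy) : ‖backwardShift f‖ ≤ ‖f‖ := by
  refine (sq_le_sq₀ (norm_nonneg _) (norm_nonneg _)).mp ?_
  rw [norm_backwardShift_sq]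
  linarith [sq_nonneg (f 0)]

theorem norm_backwardShift_pow_le (n : ℕ) (f : RealHardy) : ‖(backwardShift ^ n) f‖ ≤ ‖f‖ := by
  induction n with
  | zero => rfl
  | succ n ih =>
    rw [pow_succ', mul_apply_eq_comp]
    exact (norm_backwardShift_le _).trans ih

/-- The functions annihilated by a power of the backward shift, i.e. the polynomials, are dense. -/
theorem exists_polynomial_near (f : RealHardy) {ε : ℝ} (hε : 0 < ε) :
    ∃ p : RealHardy, (∃ d, (backwardShift ^ d) p = 0) ∧ ‖f - p‖ < ε := by
  have h := (lp.hasSum_single (p := 2) (by norm_num) f).tendsto_sum_nat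
  obtain ⟨d, hd⟩ := ((Metric.tendsto_nhds.mp h) ε hε).exists
  refine ⟨_, ⟨d, ?_⟩, by rw [← dist_eq_norm, dist_comm]; exact hd⟩
  ext m
  rw [backwardShift_pow_apply]
  rw [lp.coeFn_sum, Finset.sum_apply]
  refine Finset.sum_eq_zero fun i hi => ?_
  have : m + d ≠ i := by have := Finset.mem_range.mp hi; omega
  simp [lp.single_apply, this]

theorem norm_toFun_le (f : RealHardy) (z : 𝔻) : ‖toFun f z‖ ≤ ‖f‖ * (1 - ‖(z : ℂ)‖)⁻¹ := by
  refine tsum_of_norm_bounded ((hasSum_geometric_of_lt_one (norm_nonneg _) z.norm_lt_one).mul_left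
    ‖f‖) fun n => ?_
  rw [norm_mul, norm_pow, Complex.norm_real]
  exact mul_le_mul_of_nonneg_right (lp.norm_apply_le_norm (by norm_num) f n) (by positivity)

theorem toFun_add (f g : RealHardy) (z : 𝔻) : toFun (f + g) z = toFun f z + toFun g z := by
  refine (hasSum_toFun (f + g) z).unique ?_
  convert (hasSum_toFun f z).add (hasSum_toFun g z) using 2
  rw [lp.coeFn_add, Pi.add_apply]
  push_cast
  ring

theorem toFun_smul (c : ℝ) (f : RealHardy) (z : 𝔻) : toFun (c • f) z = c * toFun f z := by
  rw [toFun, toFun, ← tsum_mul_left]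
  refine tsum_congr fun n => ?_
  rw [lp.coeFn_smul, Pi.smul_apply, smul_eq_mul]
  push_cast
  ring

/-! ### Convolution sums along the shifts. -/

/-- The triangular half of the Gram matrix of `shift ^ k (x k)`. -/
theorem sum_inner_backwardShift_pow (x : ℕ → RealHardy) (N : ℕ) :
    ∑ i ∈ Finset.range N, ⟪∑ k ∈ Finset.range i, (backwardShift ^ (i - k)) (x k), x i⟫_ℝ =
      (‖∑ i ∈ Finset.range N, (shift ^ i) (x i)‖ ^ 2 - ∑ i ∈ Finset.range N, ‖x i‖ ^ 2) / 2 := by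
  induction N with
  | zero => simp
  | succ N ih =>
    have h : ⟪∑ k ∈ Finset.range N, (backwardShift ^ (N - k)) (x k), x N⟫_ℝ =
        ⟪∑ k ∈ Finset.range N, (shift ^ k) (x k), (shift ^ N) (x N)⟫_ℝ := by
      rw [sum_inner, sum_inner]
      refine Finset.sum_congr rfl fun k hk => ?_
      obtain ⟨l, rfl⟩ := Nat.exists_eq_add_of_le (Finset.mem_range.mp hk).le
      rw [inner_shift_pow_left, pow_add shift, mul_apply_eq_comp,
        backwardShift_pow_shift_pow, Nat.add_sub_cancel_left, real_inner_comm,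
        ← inner_shift_pow_left, real_inner_comm]
    rw [Finset.sum_range_succ, ih, Finset.sum_range_succ, Finset.sum_range_succ,
      norm_add_sq_real, norm_shift_pow, h]
    ring

/-- Only the last `d` inputs matter, so this is a finite convolution; each induction step on `d`
peels off the most recent one. -/
theorem exists_bound_convolution (d : ℕ) (f : RealHardy) (hf : (backwardShift ^ d) f = 0) :
    ∃ C : ℝ, 0 ≤ C ∧ ∀ (u : ℕ → ℝ) (N : ℕ),
      ∑ i ∈ Finset.range N, ‖∑ j ∈ Finset.range (i + 1), u j • (backwardShift ^ (i - j)) f‖ ^ 2 ≤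
        C * ∑ j ∈ Finset.range N, u j ^ 2 := by
  induction d generalizing f with
  | zero =>
    have : f = 0 := hf
    exact ⟨0, le_rfl, fun u N => by simp [this]⟩
  | succ d ih =>
    rw [pow_succ, mul_apply_eq_comp] at hf
    obtain ⟨C, hC, h⟩ := ih _ hf
    refine ⟨2 * ‖f‖ ^ 2 + 2 * C, by positivity, fun u N => ?_⟩
    have hstep : ∀ i, ‖∑ j ∈ Finset.range (i + 1), u j • (backwardShift ^ (i - j)) f‖ ^ 2 ≤
        2 * ‖f‖ ^ 2 * u i ^ 2 +
          2 * ‖∑ j ∈ Finset.range i, u j • (backwardShift ^ (i - j)) f‖ ^ 2 := by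
      intro i
      rw [Finset.sum_range_succ, Nat.sub_self, pow_zero, one_apply_eq_self]
      have h1 := parallelogram_law_with_norm ℝ
        (∑ j ∈ Finset.range i, u j • (backwardShift ^ (i - j)) f) (u i • f)
      have h2 : ‖u i • f‖ ^ 2 = u i ^ 2 * ‖f‖ ^ 2 := by
        rw [norm_smul, mul_pow, Real.norm_eq_abs, sq_abs]
      nlinarith [sq_nonneg ‖(∑ j ∈ Finset.range i, u j • (backwardShift ^ (i - j)) f) - u i • f‖]
    -- Without its last term the convolution of `f` is that of `backwardShift f` delayed by one; the
    -- term at `i = 0` is empty.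
    have hshift : ∑ i ∈ Finset.range N,
        ‖∑ j ∈ Finset.range i, u j • (backwardShift ^ (i - j)) f‖ ^ 2 ≤
          C * ∑ j ∈ Finset.range N, u j ^ 2 := by
      refine le_trans ?_ (h u N)
      cases N with
      | zero => simp
      | succ N =>
        rw [Finset.sum_range_succ', Finset.sum_range_succ]
        simp only [Finset.range_zero, Finset.sum_empty, norm_zero]
        have : ∀ i, ∑ j ∈ Finset.range (i + 1), u j • (backwardShift ^ (i + 1 - j)) f =
            ∑ j ∈ Finset.range (i + 1), u j • (backwardShift ^ (i - j)) (backwardShift f) := by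
          intro i
          refine Finset.sum_congr rfl fun j hj => ?_
          rw [Nat.succ_sub (Nat.lt_succ_iff.mp (Finset.mem_range.mp hj)), pow_succ,
            mul_apply_eq_comp]
        simp only [this]
        gcongr
        positivity
    calc _ ≤ ∑ i ∈ Finset.range N, (2 * ‖f‖ ^ 2 * u i ^ 2 +
          2 * ‖∑ j ∈ Finset.range i, u j • (backwardShift ^ (i - j)) f‖ ^ 2) :=
        Finset.sum_le_sum fun i _ => hstep i
      _ ≤ _ := by
        rw [Finset.sum_add_distrib, ← Finset.mul_sum, ← Finset.mul_sum]
        linarith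

theorem tendsto_convolution_zero (d : ℕ) (f : RealHardy) (hf : (backwardShift ^ d) f = 0)
    {a : ℕ → ℝ} (ha : Filter.Tendsto a Filter.atTop (nhds 0)) :
    Filter.Tendsto (fun n => ∑ k ∈ Finset.range n, a k • (backwardShift ^ (n - k)) f)
      Filter.atTop (nhds 0) := by
  induction d generalizing f with
  | zero =>
    have : f = 0 := hf
    simp [this]
  | succ d ih =>
    rw [pow_succ, mul_apply_eq_comp] at hf
    rw [← Filter.tendsto_add_atTop_iff_nat 1]
    have h := (ih _ hf).add (ha.smul_const (backwardShift f))
    rw [zero_smul, add_zero] at h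
    refine h.congr fun n => ?_
    rw [Finset.sum_range_succ, Nat.add_sub_cancel_left, pow_one]
    congr 1
    refine Finset.sum_congr rfl fun k hk => ?_
    rw [Nat.succ_sub (Finset.mem_range.mp hk).le, pow_succ, mul_apply_eq_comp]

/-! ### The deflated shift and its energy balance. -/

/-- The operator `f ↦ f - ⟪v, f⟫ v`, for a unit vector `v` the projection onto `v^⊥`. -/
noncomputable def deflate (v : RealHardy) : RealHardy →L[ℝ] RealHardy :=
  ContinuousLinearMap.id ℝ RealHardy - (innerSL ℝ v).smulRight v

theorem deflate_apply (v f : RealHardy) : deflate v f = f - ⟪v, f⟫_ℝ • v := rfl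

theorem norm_deflate_sq {v : RealHardy} (hv : ‖v‖ = 1) (f : RealHardy) :
    ‖deflate v f‖ ^ 2 = ‖f‖ ^ 2 - ⟪v, f⟫_ℝ ^ 2 := by
  rw [deflate_apply, norm_sub_sq_real, inner_smul_right, norm_smul, hv, real_inner_comm,
    mul_one, Real.norm_eq_abs, sq_abs]
  ring

/-- The backward shift following the removal of the `g` component and then of the `q` component. -/
noncomputable def deflatedShift (g q : RealHardy) : RealHardy →L[ℝ] RealHardy :=
  backwardShift ∘L deflate q ∘L deflate g

theorem deflatedShift_apply (g q f : RealHardy) :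
    deflatedShift g q f =
      backwardShift (f - (⟪g, f⟫_ℝ • g + ⟪q, deflate g f⟫_ℝ • q)) := by
  rw [← sub_sub]
  rfl

section

variable {g q : RealHardy}

/-- Each of the three stages loses the square of what it discards. On `M` the last loss will vanish,
which makes the balance exact. -/
theorem norm_deflatedShift_sq (hg : ‖g‖ = 1) (hq : ‖q‖ = 1) (f : RealHardy) :
    ‖deflatedShift g q f‖ ^ 2 = ‖f‖ ^ 2 - ⟪g, f⟫_ℝ ^ 2 - ⟪q, deflate g f⟫_ℝ ^ 2 -
      (deflate q (deflate g f) 0) ^ 2 := by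
  rw [← norm_deflate_sq hg, ← norm_deflate_sq hq, ← norm_backwardShift_sq]
  rfl

theorem sum_sq_add_sq_le (hg : ‖g‖ = 1) (hq : ‖q‖ = 1) (f : RealHardy) (N : ℕ) :
    ∑ n ∈ Finset.range N, (⟪g, (deflatedShift g q ^ n) f⟫_ℝ ^ 2 +
      ⟪q, deflate g ((deflatedShift g q ^ n) f)⟫_ℝ ^ 2) + ‖(deflatedShift g q ^ N) f‖ ^ 2 ≤
        ‖f‖ ^ 2 := by
  induction N with
  | zero => simp
  | succ N ih =>
    rw [Finset.sum_range_succ, pow_succ' (deflatedShift g q), mul_apply_eq_comp, norm_deflatedShift_sq hg hq]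
    linarith [sq_nonneg (deflate q (deflate g ((deflatedShift g q ^ N) f)) 0)]

theorem norm_deflatedShift_pow_le (hg : ‖g‖ = 1) (hq : ‖q‖ = 1) (f : RealHardy) (N : ℕ) :
    ‖(deflatedShift g q ^ N) f‖ ≤ ‖f‖ := by
  refine (sq_le_sq₀ (norm_nonneg _) (norm_nonneg _)).mp ?_
  have := sum_sq_add_sq_le hg hq f N
  have h : 0 ≤ ∑ n ∈ Finset.range N, (⟪g, (deflatedShift g q ^ n) f⟫_ℝ ^ 2 +
      ⟪q, deflate g ((deflatedShift g q ^ n) f)⟫_ℝ ^ 2) :=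
    Finset.sum_nonneg fun n _ => by positivity
  linarith

theorem summable_sq_add_sq (hg : ‖g‖ = 1) (hq : ‖q‖ = 1) (f : RealHardy) :
    Summable fun n => ⟪g, (deflatedShift g q ^ n) f⟫_ℝ ^ 2 +
      ⟪q, deflate g ((deflatedShift g q ^ n) f)⟫_ℝ ^ 2 :=
  summable_of_sum_range_le (c := ‖f‖ ^ 2) (fun n => by positivity) fun N => by
    linarith [sum_sq_add_sq_le hg hq f N, sq_nonneg ‖(deflatedShift g q ^ N) f‖]

theorem summable_fst_sq (hg : ‖g‖ = 1) (hq : ‖q‖ = 1) (f : RealHardy) :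
    Summable fun n => ⟪g, (deflatedShift g q ^ n) f⟫_ℝ ^ 2 :=
  (summable_sq_add_sq hg hq f).of_nonneg_of_le (fun _ => sq_nonneg _) fun _ =>
    le_add_of_nonneg_right (sq_nonneg _)

theorem summable_snd_sq (hg : ‖g‖ = 1) (hq : ‖q‖ = 1) (f : RealHardy) :
    Summable fun n => ⟪q, deflate g ((deflatedShift g q ^ n) f)⟫_ℝ ^ 2 :=
  (summable_sq_add_sq hg hq f).of_nonneg_of_le (fun _ => sq_nonneg _) fun _ =>
    le_add_of_nonneg_left (sq_nonneg _)

/-! ### The driven system and strong convergence of the powers to zero. -/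

/-- Duhamel's formula for the driven system `F (i + 1) = deflatedShift g q (F i) + u (i + 1) f`. -/
theorem driven_eq {f : RealHardy} {u : ℕ → ℝ} {F : ℕ → RealHardy} (h0 : F 0 = u 0 • f)
    (hF : ∀ i, F (i + 1) = deflatedShift g q (F i) + u (i + 1) • f) (i : ℕ) :
    F i = ∑ j ∈ Finset.range (i + 1), u j • (backwardShift ^ (i - j)) f -
      ∑ k ∈ Finset.range i,
        (backwardShift ^ (i - k)) (⟪g, F k⟫_ℝ • g + ⟪q, deflate g (F k)⟫_ℝ • q) := by
  induction i with
  | zero => simp [h0]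
  | succ i ih =>
    have hp : ∀ {m j}, j < m → ∀ y, (backwardShift ^ (m - j)) y =
        backwardShift ((backwardShift ^ (m - 1 - j)) y) := by
      intro m j hj y
      rw [← mul_apply_eq_comp, ← pow_succ']
      congr 2
      omega
    have h1 : ∑ j ∈ Finset.range (i + 1 + 1), u j • (backwardShift ^ (i + 1 - j)) f =
        backwardShift (∑ j ∈ Finset.range (i + 1), u j • (backwardShift ^ (i - j)) f) +
          u (i + 1) • f := by
      rw [Finset.sum_range_succ, Nat.sub_self, pow_zero, one_apply_eq_self, map_sum]
      congr 1
      refine Finset.sum_congr rfl fun j hj => ?_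
      rw [map_smul, hp (Finset.mem_range.mp hj), Nat.add_sub_cancel]
    have h2 : ∀ x : ℕ → RealHardy,
        ∑ k ∈ Finset.range (i + 1), (backwardShift ^ (i + 1 - k)) (x k) =
          backwardShift (∑ k ∈ Finset.range i, (backwardShift ^ (i - k)) (x k)) +
            backwardShift (x i) := by
      intro x
      rw [Finset.sum_range_succ, Nat.add_sub_cancel_left, pow_one, map_sum]
      congr 1
      refine Finset.sum_congr rfl fun j hj => ?_
      rw [hp ((Finset.mem_range.mp hj).trans (Nat.lt_succ_self i)), Nat.succ_sub_one]
    have h3 := congrArg backwardShift ih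
    rw [map_sub] at h3
    rw [hF, deflatedShift_apply, map_sub, h1, h2, h3]
    abel

/-- Pair Duhamel's formula with the discarded vectors `x i` and sum. The double sum is half a Gram
matrix of `shift ^ i (x i)`, hence a nonnegative square minus `∑ ‖x i‖² / 2`, and this last term
cancels against the one in `⟪F i, x i⟫`. No orthogonality of `g` and `q` is needed. -/
theorem driven_energy (hg : ‖g‖ = 1) (hq : ‖q‖ = 1) {f : RealHardy} {u : ℕ → ℝ}
    {F : ℕ → RealHardy} (h0 : F 0 = u 0 • f)
    (hF : ∀ i, F (i + 1) = deflatedShift g q (F i) + u (i + 1) • f) (N : ℕ) :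
    ∑ i ∈ Finset.range N, (⟪g, F i⟫_ℝ ^ 2 + ⟪q, deflate g (F i)⟫_ℝ ^ 2) ≤
      8 * ∑ i ∈ Finset.range N,
        ‖∑ j ∈ Finset.range (i + 1), u j • (backwardShift ^ (i - j)) f‖ ^ 2 := by
  set p : ℕ → RealHardy := fun i =>
    ∑ j ∈ Finset.range (i + 1), u j • (backwardShift ^ (i - j)) f with hp
  set x : ℕ → RealHardy := fun i => ⟪g, F i⟫_ℝ • g + ⟪q, deflate g (F i)⟫_ℝ • q with hx
  set e : ℕ → ℝ := fun i => ⟪g, F i⟫_ℝ ^ 2 + ⟪q, deflate g (F i)⟫_ℝ ^ 2 with he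
  have hr := sum_inner_backwardShift_pow x N
  have hFx : ∀ i, ⟪∑ k ∈ Finset.range i, (backwardShift ^ (i - k)) (x k), x i⟫_ℝ =
      ⟪p i, x i⟫_ℝ - ⟪F i, x i⟫_ℝ := fun i => by
    rw [← inner_sub_left]
    congr 1
    rw [driven_eq h0 hF i, sub_sub_cancel]
  -- The second coefficient is taken after deflation by `g`, so the cross term in `⟪q, g⟫` is
  -- exactly the one in `‖x i‖²`.
  have hxx : ∀ i, ⟪F i, x i⟫_ℝ = (‖x i‖ ^ 2 + e i) / 2 := fun i => by
    have h1 : ⟪q, deflate g (F i)⟫_ℝ = ⟪q, F i⟫_ℝ - ⟪g, F i⟫_ℝ * ⟪q, g⟫_ℝ := by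
      rw [deflate_apply, inner_sub_right, inner_smul_right]
    have h2 : ⟪F i, x i⟫_ℝ = ⟪g, F i⟫_ℝ * ⟪g, F i⟫_ℝ + ⟪q, deflate g (F i)⟫_ℝ * ⟪q, F i⟫_ℝ := by
      rw [hx, inner_add_right, inner_smul_right, inner_smul_right, real_inner_comm g,
        real_inner_comm q]
    have h3 : ‖x i‖ ^ 2 = ⟪g, F i⟫_ℝ ^ 2 + 2 * (⟪g, F i⟫_ℝ * ⟪q, deflate g (F i)⟫_ℝ * ⟪q, g⟫_ℝ) +
        ⟪q, deflate g (F i)⟫_ℝ ^ 2 := by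
      rw [hx, norm_add_sq_real, norm_smul, norm_smul, hg, hq, inner_smul_left, inner_smul_right,
        real_inner_comm q g]
      simp only [mul_one, Real.norm_eq_abs, sq_abs, conj_trivial]
      ring
    rw [h2, h3, he]
    linear_combination (-⟪q, deflate g (F i)⟫_ℝ) * h1
  -- Weighted so that only half of the `e i / 2` available on the left is absorbed; the remaining `e
  -- i / 4` yields the constant `8`.
  have hpx : ∀ i, ⟪p i, x i⟫_ℝ ≤ 2 * ‖p i‖ ^ 2 + e i / 4 := fun i => by
    have h1 := real_inner_le_norm (p i) (x i)
    have h2 : ‖x i‖ ^ 2 ≤ 2 * e i := by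
      have h3 := parallelogram_law_with_norm ℝ (⟪g, F i⟫_ℝ • g) (⟪q, deflate g (F i)⟫_ℝ • q)
      simp only [norm_smul, hg, hq, mul_one, Real.norm_eq_abs, sq_abs] at h3
      simp only [hx, he]
      nlinarith [sq_nonneg ‖⟪g, F i⟫_ℝ • g - ⟪q, deflate g (F i)⟫_ℝ • q‖]
    nlinarith [sq_nonneg (4 * ‖p i‖ - ‖x i‖)]
  have hsum := Finset.sum_le_sum (s := Finset.range N) fun i _ => hpx i
  simp only [hFx, hxx, Finset.sum_sub_distrib, ← Finset.sum_div, Finset.sum_add_distrib] at hr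
  rw [Finset.sum_add_distrib, ← Finset.mul_sum, ← Finset.sum_div] at hsum
  have he' : ∑ i ∈ Finset.range N, e i =
    ∑ i ∈ Finset.range N, (⟪g, F i⟫_ℝ ^ 2 + ⟪q, deflate g (F i)⟫_ℝ ^ 2) := rfl
  have := sq_nonneg ‖∑ i ∈ Finset.range N, (shift ^ i) (x i)‖
  linarith

/-- Convolution with the coefficient sequences of a polynomial is bounded on `ℓ²`. -/
theorem exists_bound_coeff_convolution (hg : ‖g‖ = 1) (hq : ‖q‖ = 1) {f : RealHardy} {d : ℕ}
    (hf : (backwardShift ^ d) f = 0) :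
    ∃ C : ℝ, 0 ≤ C ∧ ∀ (u : ℕ → ℝ) (N : ℕ),
      ∑ i ∈ Finset.range N,
        ((∑ j ∈ Finset.range (i + 1), u j * ⟪g, (deflatedShift g q ^ (i - j)) f⟫_ℝ) ^ 2 +
        (∑ j ∈ Finset.range (i + 1),
          u j * ⟪q, deflate g ((deflatedShift g q ^ (i - j)) f)⟫_ℝ) ^ 2) ≤
        C * ∑ j ∈ Finset.range N, u j ^ 2 := by
  obtain ⟨C, hC, h⟩ := exists_bound_convolution d f hf
  refine ⟨8 * C, by positivity, fun u N => ?_⟩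
  have key := driven_energy hg hq (f := f) (u := u)
    (F := fun i => ∑ j ∈ Finset.range (i + 1), u j • (deflatedShift g q ^ (i - j)) f)
    (by simp) (fun i => by
      rw [Finset.sum_range_succ _ (i + 1), Nat.sub_self, pow_zero, one_apply_eq_self, map_sum]
      congr 1
      refine Finset.sum_congr rfl fun j hj => ?_
      rw [Nat.succ_sub (Nat.lt_succ_iff.mp (Finset.mem_range.mp hj)), pow_succ',
        mul_apply_eq_comp, map_smul]) N
  simp only [map_sum, map_smul, inner_sum, inner_smul_right] at key
  refine key.trans ?_
  rw [mul_assoc]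
  gcongr
  exact h u N

/-- Convolution by a kernel bounded on `ℓ²` is bounded on average on translates of a function. -/
theorem sum_norm_sq_convolution_le {a : ℕ → ℝ} {C : ℝ}
    (ha : ∀ (u : ℕ → ℝ) (N : ℕ), ∑ i ∈ Finset.range N,
      (∑ j ∈ Finset.range (i + 1), u j * a (i - j)) ^ 2 ≤ C * ∑ j ∈ Finset.range N, u j ^ 2)
    (hC : 0 ≤ C) (γ : RealHardy) (N : ℕ) :
    ∑ i ∈ Finset.range N,
      ‖∑ k ∈ Finset.range (i + 1), a k • (backwardShift ^ (i + 1 - k)) γ‖ ^ 2 ≤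
        C * (N * ‖γ‖ ^ 2) := by
  have h1 := hasSum_sum (s := Finset.range N) fun i _ =>
    hasSum_sq (∑ k ∈ Finset.range (i + 1), a k • (backwardShift ^ (i + 1 - k)) γ)
  have h2 := (hasSum_sum (s := Finset.range N) fun j _ =>
    hasSum_sq ((backwardShift ^ (j + 1)) γ)).mul_left C
  refine (hasSum_le (fun m => ?_) h1 h2).trans ?_
  -- For a fixed coefficient index `m` this is a scalar convolution, with input `j ↦ (backwardShift
  -- ^ (j + 1)) γ m`; the scalar bounds are then summed over `m`.
  · refine le_trans (le_of_eq ?_) (ha (fun j => (backwardShift ^ (j + 1)) γ m) N)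
    refine Finset.sum_congr rfl fun i _ => ?_
    congr 1
    rw [lp.coeFn_sum, Finset.sum_apply, ← Finset.sum_range_reflect]
    refine Finset.sum_congr rfl fun k hk => ?_
    have hk := Finset.mem_range.mp hk
    rw [lp.coeFn_smul, Pi.smul_apply, smul_eq_mul, mul_comm,
      show i + 1 - (i + 1 - 1 - k) = k + 1 by omega, Nat.add_sub_cancel]
  · gcongr
    calc _ ≤ ∑ j ∈ Finset.range N, ‖γ‖ ^ 2 := by
          gcongr
          exact norm_backwardShift_pow_le _ _
      _ = _ := by simp

theorem tendsto_deflatedShift_pow_polynomial (hg : ‖g‖ = 1) (hq : ‖q‖ = 1) {f : RealHardy} {d : ℕ}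
    (hf : (backwardShift ^ d) f = 0) {δ : ℝ} (hδ : 0 < δ) :
    ∃ n, ‖(deflatedShift g q ^ n) f‖ < δ := by
  by_contra! hlow
  obtain ⟨C, hC, hconv⟩ := exists_bound_coeff_convolution hg hq hf
  set a : ℕ → ℝ := fun n => ⟪g, (deflatedShift g q ^ n) f⟫_ℝ
  set b : ℕ → ℝ := fun n => ⟪q, deflate g ((deflatedShift g q ^ n) f)⟫_ℝ
  have htend : ∀ {c : ℕ → ℝ}, Summable (fun n => c n ^ 2) →
      Filter.Tendsto c Filter.atTop (nhds 0) := by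
    intro c hc
    have := hc.tendsto_atTop_zero.sqrt
    simp only [Real.sqrt_sq_eq_abs, Real.sqrt_zero] at this
    exact (tendsto_zero_iff_abs_tendsto_zero c).mpr this
  have ha := htend (summable_fst_sq hg hq f)
  have hb := htend (summable_snd_sq hg hq f)
  -- Over `2 n₀` times the two error terms contribute at most `8 C n₀ ε²`, which must stay below `n₀
  -- δ² / 4`.
  obtain ⟨ε, hε, hεC⟩ : ∃ ε : ℝ, 0 < ε ∧ 4 * C * ε ^ 2 < δ ^ 2 / 8 := by
    refine ⟨δ / (8 * (C + 1)), by positivity, ?_⟩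
    rw [div_pow, mul_div_assoc', div_lt_div_iff₀ (by positivity) (by positivity)]
    have : 0 < δ ^ 2 := by positivity
    nlinarith [mul_nonneg this.le hC, mul_nonneg (mul_nonneg this.le hC) hC]
  obtain ⟨g', ⟨dg, hg'⟩, hgg⟩ := exists_polynomial_near g hε
  obtain ⟨q', ⟨dq, hq'⟩, hqq⟩ := exists_polynomial_near q hε
  have hsmall := (tendsto_convolution_zero dg g' hg' ha).add (tendsto_convolution_zero dq q' hq' hb)
  rw [add_zero] at hsmall
  obtain ⟨n₁, hn₁⟩ := Filter.eventually_atTop.mp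
    ((tendsto_zero_iff_norm_tendsto_zero.mp hsmall).eventually_lt_const (half_pos hδ))
  set Y : RealHardy → (ℕ → ℝ) → ℕ → RealHardy := fun γ c i =>
    ∑ k ∈ Finset.range (i + 1), c k • (backwardShift ^ (i + 1 - k)) γ with hY
  have hbig : ∀ i, n₁ + d ≤ i → δ ^ 2 / 4 ≤ 2 * ‖Y (g - g') a i‖ ^ 2 + 2 * ‖Y (q - q') b i‖ ^ 2 := by
    intro i hi
    -- A unit impulse at time `0` makes the driven state the orbit of `f`; the free term vanishes
    -- from time `d` on.
    have h1 := driven_eq (g := g) (q := q) (f := f) (u := fun n => if n = 0 then 1 else 0)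
      (F := fun n => (deflatedShift g q ^ n) f) (by simp)
      (fun n => by simp [pow_succ']) (i + 1)
    have h2 : ∑ j ∈ Finset.range (i + 1 + 1), (if j = 0 then (1 : ℝ) else 0) •
        (backwardShift ^ (i + 1 - j)) f = 0 := by
      rw [Finset.sum_eq_single 0]
      · obtain ⟨l, hl⟩ := Nat.exists_eq_add_of_le (show d ≤ i + 1 by omega)
        simp [hl, add_comm d l, pow_add, hf]
      · intro j _ hj
        simp [hj]
      · simp
    rw [h2, zero_sub] at h1
    have h3 : (deflatedShift g q ^ (i + 1)) f =
        -((∑ k ∈ Finset.range (i + 1), a k • (backwardShift ^ (i + 1 - k)) g' +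
          ∑ k ∈ Finset.range (i + 1), b k • (backwardShift ^ (i + 1 - k)) q') +
          (Y (g - g') a i + Y (q - q') b i)) := by
      rw [h1, hY]
      simp only [map_add, map_sub, map_smul, smul_sub, Finset.sum_add_distrib,
        Finset.sum_sub_distrib]
      abel
    have h4 := hlow (i + 1)
    rw [h3, norm_neg] at h4
    have h5 := h4.trans (norm_add_le _ _)
    have h6 := hn₁ (i + 1) (by omega)
    have h7 := norm_add_le (Y (g - g') a i) (Y (q - q') b i)
    have h8 : δ / 2 ≤ ‖Y (g - g') a i‖ + ‖Y (q - q') b i‖ := by linarith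
    nlinarith [sq_nonneg (‖Y (g - g') a i‖ - ‖Y (q - q') b i‖)]
  have hYa := sum_norm_sq_convolution_le (a := a) (fun u N => le_trans
    (Finset.sum_le_sum fun i _ => le_add_of_nonneg_right (sq_nonneg _)) (hconv u N)) hC (g - g')
  have hYb := sum_norm_sq_convolution_le (a := b) (fun u N => le_trans
    (Finset.sum_le_sum fun i _ => le_add_of_nonneg_left (sq_nonneg _)) (hconv u N)) hC (q - q')
  -- In a window of length `2 n₀` the second half lies entirely in the range where `hbig` applies,
  -- so the mean square is bounded below.
  set n₀ := n₁ + d + 1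
  have hlower : (n₀ : ℝ) * (δ ^ 2 / 4) ≤ ∑ i ∈ Finset.range (n₀ + n₀),
      (2 * ‖Y (g - g') a i‖ ^ 2 + 2 * ‖Y (q - q') b i‖ ^ 2) := by
    rw [Finset.sum_range_add]
    refine le_trans ?_ (le_add_of_nonneg_left (Finset.sum_nonneg fun i _ => by positivity))
    calc _ = ∑ i ∈ Finset.range n₀, δ ^ 2 / 4 := by simp
      _ ≤ _ := Finset.sum_le_sum fun i _ => hbig _ (by omega)
  rw [Finset.sum_add_distrib, ← Finset.mul_sum, ← Finset.mul_sum] at hlower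
  have h1 := hYa (n₀ + n₀)
  have h2 := hYb (n₀ + n₀)
  have h3 : ‖g - g'‖ ^ 2 ≤ ε ^ 2 := by gcongr
  have h4 : ‖q - q'‖ ^ 2 ≤ ε ^ 2 := by gcongr
  have hn₀ : (0 : ℝ) < n₀ := by positivity
  have h5 : C * (((n₀ + n₀ : ℕ) : ℝ) * ‖g - g'‖ ^ 2) ≤ C * (((n₀ + n₀ : ℕ) : ℝ) * ε ^ 2) := by gcongr
  have h6 : C * (((n₀ + n₀ : ℕ) : ℝ) * ‖q - q'‖ ^ 2) ≤ C * (((n₀ + n₀ : ℕ) : ℝ) * ε ^ 2) := by gcongr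
  have h7 : (n₀ : ℝ) * (δ ^ 2 / 4) ≤ n₀ * (2 * (4 * C * ε ^ 2)) := by
    simp only [Nat.cast_add] at h1 h2 h5 h6
    simp only [hY] at hlower
    linarith
  nlinarith [mul_lt_mul_of_pos_left hεC hn₀]

/-- One small iterate suffices, because all powers are contractions; polynomials suffice, because
they are dense. -/
theorem tendsto_deflatedShift_pow (hg : ‖g‖ = 1) (hq : ‖q‖ = 1) (f : RealHardy) :
    Filter.Tendsto (fun n => (deflatedShift g q ^ n) f) Filter.atTop (nhds 0) := by
  rw [Metric.tendsto_atTop]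
  intro ε hε
  obtain ⟨p, ⟨d, hp⟩, hfp⟩ := exists_polynomial_near f (half_pos hε)
  obtain ⟨n, hn⟩ := tendsto_deflatedShift_pow_polynomial hg hq hp (half_pos hε)
  refine ⟨n, fun m hm => ?_⟩
  obtain ⟨l, rfl⟩ := Nat.exists_eq_add_of_le' hm
  have h1 : (deflatedShift g q ^ (l + n)) f =
      (deflatedShift g q ^ (l + n)) (f - p) +
        (deflatedShift g q ^ l) ((deflatedShift g q ^ n) p) := by
    rw [← mul_apply_eq_comp, ← pow_add, map_sub, sub_add_cancel]
  rw [dist_zero_right, h1]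
  linarith [norm_add_le ((deflatedShift g q ^ (l + n)) (f - p))
    ((deflatedShift g q ^ l) ((deflatedShift g q ^ n) p)),
    norm_deflatedShift_pow_le hg hq (f - p) (l + n),
    norm_deflatedShift_pow_le hg hq ((deflatedShift g q ^ n) p) l]

end

/-! ### Coefficient functions and the representation of an invariant subspace. -/

theorem memℓp_of_summable_sq {a : ℕ → ℝ} (ha : Summable fun n => a n ^ 2) : Memℓp a 2 := by
  rw [memℓp_gen_iff (by norm_num)]
  simpa using ha

section

variable {g q : RealHardy}

/-- The function whose coefficients are the `g` components along the orbit of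
`deflatedShift g q`. -/
noncomputable def fstCoeff (hg : ‖g‖ = 1) (hq : ‖q‖ = 1) : RealHardy →ₗ[ℝ] RealHardy where
  toFun f := ⟨fun n => ⟪g, (deflatedShift g q ^ n) f⟫_ℝ,
    memℓp_of_summable_sq (summable_fst_sq hg hq f)⟩
  map_add' f₁ f₂ := by
    ext n
    change ⟪g, (deflatedShift g q ^ n) (f₁ + f₂)⟫_ℝ = _ + _
    rw [map_add, inner_add_right]
  map_smul' c f := by
    ext n
    change ⟪g, (deflatedShift g q ^ n) (c • f)⟫_ℝ = c * _
    rw [map_smul, inner_smul_right]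

/-- The function whose coefficients are the `q` components along the orbit of
`deflatedShift g q`. -/
noncomputable def sndCoeff (hg : ‖g‖ = 1) (hq : ‖q‖ = 1) : RealHardy →ₗ[ℝ] RealHardy where
  toFun f := ⟨fun n => ⟪q, deflate g ((deflatedShift g q ^ n) f)⟫_ℝ,
    memℓp_of_summable_sq (summable_snd_sq hg hq f)⟩
  map_add' f₁ f₂ := by
    ext n
    change ⟪q, deflate g ((deflatedShift g q ^ n) (f₁ + f₂))⟫_ℝ = _ + _
    rw [map_add, map_add, inner_add_right]
  map_smul' c f := by
    ext n
    change ⟪q, deflate g ((deflatedShift g q ^ n) (c • f))⟫_ℝ = c * _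
    rw [map_smul, map_smul, inner_smul_right]

variable (hg : ‖g‖ = 1) (hq : ‖q‖ = 1)

theorem fstCoeff_apply (f : RealHardy) (n : ℕ) :
    fstCoeff hg hq f n = ⟪g, (deflatedShift g q ^ n) f⟫_ℝ := rfl

theorem sndCoeff_apply (f : RealHardy) (n : ℕ) :
    sndCoeff hg hq f n = ⟪q, deflate g ((deflatedShift g q ^ n) f)⟫_ℝ := rfl

theorem fstCoeff_deflatedShift (f : RealHardy) :
    fstCoeff hg hq (deflatedShift g q f) = backwardShift (fstCoeff hg hq f) := by
  ext n
  rw [backwardShift_apply, fstCoeff_apply, fstCoeff_apply, pow_succ, mul_apply_eq_comp]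

theorem sndCoeff_deflatedShift (f : RealHardy) :
    sndCoeff hg hq (deflatedShift g q f) = backwardShift (sndCoeff hg hq f) := by
  ext n
  rw [backwardShift_apply, sndCoeff_apply, sndCoeff_apply, pow_succ, mul_apply_eq_comp]

theorem deflatedShift_pow_mem {M : Submodule ℝ RealHardy}
    (hA : ∀ f ∈ M, deflatedShift g q f ∈ M) {f : RealHardy} (hf : f ∈ M) (n : ℕ) :
    (deflatedShift g q ^ n) f ∈ M := by
  induction n with
  | zero => exact hf
  | succ n ih =>
    rw [pow_succ', mul_apply_eq_comp]
    exact hA _ ih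

/-- The energy balance telescopes along the orbit, and the remainder `‖(deflatedShift g q ^ N) f‖²`
tends to zero. -/
theorem norm_sq_eq_fstCoeff_add_sndCoeff {M : Submodule ℝ RealHardy}
    (hA : ∀ f ∈ M, deflatedShift g q f ∈ M) (hM : ∀ f ∈ M, deflate q (deflate g f) 0 = 0)
    {f : RealHardy} (hf : f ∈ M) :
    ‖f‖ ^ 2 = ‖fstCoeff hg hq f‖ ^ 2 + ‖sndCoeff hg hq f‖ ^ 2 := by
  have hsum : ∀ N, ∑ n ∈ Finset.range N, (fstCoeff hg hq f n ^ 2 + sndCoeff hg hq f n ^ 2) =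
      ‖f‖ ^ 2 - ‖(deflatedShift g q ^ N) f‖ ^ 2 := by
    intro N
    induction N with
    | zero => simp
    | succ N ih =>
      rw [Finset.sum_range_succ, ih, pow_succ' (deflatedShift g q), mul_apply_eq_comp,
        norm_deflatedShift_sq hg hq, hM _ (deflatedShift_pow_mem hA hf N), fstCoeff_apply,
        sndCoeff_apply]
      ring
  have h1 := ((hasSum_sq (fstCoeff hg hq f)).add (hasSum_sq (sndCoeff hg hq f))).tendsto_sum_nat
  have h2 := ((tendsto_deflatedShift_pow hg hq f).norm.pow 2).const_sub (‖f‖ ^ 2)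
  refine tendsto_nhds_unique ?_ h1
  simp only [hsum]
  simpa using h2

/-- One step splits off the two components and a factor `z`. The remainder after `N` steps vanishes
pointwise because evaluation at `z` is bounded. -/
theorem toFun_eq_mul_fstCoeff_add_mul_sndCoeff {M : Submodule ℝ RealHardy}
    (hA : ∀ f ∈ M, deflatedShift g q f ∈ M) (hM : ∀ f ∈ M, deflate q (deflate g f) 0 = 0)
    {f : RealHardy} (hf : f ∈ M) (z : 𝔻) :
    toFun f z = toFun g z * toFun (fstCoeff hg hq f) z +
      toFun q z * toFun (sndCoeff hg hq f) z := by
  have hstep : ∀ y ∈ M, toFun y z = ⟪g, y⟫_ℝ * toFun g z + ⟪q, deflate g y⟫_ℝ * toFun q z +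
      z * toFun (deflatedShift g q y) z := by
    intro y hy
    have h : y = ⟪g, y⟫_ℝ • g + ⟪q, deflate g y⟫_ℝ • q + shift (deflatedShift g q y) := by
      change _ = _ + shift (backwardShift (deflate q (deflate g y)))
      rw [shift_backwardShift (hM y hy), deflate_apply q, deflate_apply g y]
      abel
    conv_lhs => rw [h]
    rw [toFun_add, toFun_add, toFun_smul, toFun_smul, toFun_shift]
  have hsum : ∀ N, ∑ n ∈ Finset.range N,
      (toFun g z * ((fstCoeff hg hq f n : ℝ) * (z : ℂ) ^ n) +
        toFun q z * ((sndCoeff hg hq f n : ℝ) * (z : ℂ) ^ n)) =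
      toFun f z - (z : ℂ) ^ N * toFun ((deflatedShift g q ^ N) f) z := by
    intro N
    induction N with
    | zero => simp
    | succ N ih =>
      rw [Finset.sum_range_succ, ih, hstep _ (deflatedShift_pow_mem hA hf N),
        pow_succ' (deflatedShift g q), mul_apply_eq_comp, fstCoeff_apply, sndCoeff_apply]
      ring
  have h1 := (((hasSum_toFun (fstCoeff hg hq f) z).mul_left (toFun g z)).add
    ((hasSum_toFun (sndCoeff hg hq f) z).mul_left (toFun q z))).tendsto_sum_nat
  simp only [hsum] at h1
  refine tendsto_nhds_unique ?_ h1
  have h2 : Filter.Tendsto (fun N => (z : ℂ) ^ N * toFun ((deflatedShift g q ^ N) f) z)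
      Filter.atTop (nhds 0) := by
    refine squeeze_zero_norm (fun N => ?_)
      (by simpa only [norm_zero, zero_mul] using
        (tendsto_deflatedShift_pow hg hq f).norm.mul_const (1 - ‖(z : ℂ)‖)⁻¹)
    rw [norm_mul, norm_pow]
    exact (mul_le_of_le_one_left (norm_nonneg _)
      (pow_le_one₀ (norm_nonneg _) z.norm_lt_one.le)).trans (norm_toFun_le _ z)
  simpa using h2.const_sub (toFun f z)

end

/-! ### The normalized generator and the defect vector. -/

theorem mem_range_shift_iff {f : RealHardy} :
    f ∈ LinearMap.range shift.toLinearMap ↔ f 0 = 0 := by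
  constructor
  · rintro ⟨h, rfl⟩
    exact shift_apply_zero h
  · exact fun hf => ⟨backwardShift f, shift_backwardShift hf⟩

theorem toFun_zero_eq_zero_iff {f : RealHardy} : toFun f 0 = 0 ↔ f 0 = 0 := by
  rw [toFun_zero, Complex.ofReal_eq_zero]

theorem toFun_zero_pos_iff {f : RealHardy} : 0 < toFun f 0 ↔ 0 < f 0 := by
  rw [toFun_zero, Complex.zero_lt_real]

theorem isClosed_range_shift :
    IsClosed (LinearMap.range shift.toLinearMap : Set RealHardy) :=
  (AddMonoidHomClass.isometry_of_norm shift norm_shift).isClosedEmbedding.isClosed_range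

theorem IsNormalizedGenerator.inner_eq_zero {M : Submodule ℝ RealHardy} {g f : RealHardy}
    (hg : IsNormalizedGenerator M g) (hf : f ∈ M) (hf0 : f 0 = 0) : ⟪g, f⟫_ℝ = 0 :=
  hg.2.2.1 f ⟨hf, mem_range_shift_iff.mpr hf0⟩

/-- Orthogonality of `g` to `f - (f 0 / g 0) • g` forces `⟪g, f⟫ = f 0 / g 0`. -/
theorem IsNormalizedGenerator.deflate_apply_zero {M : Submodule ℝ RealHardy} {g f : RealHardy}
    (hg : IsNormalizedGenerator M g) (hf : f ∈ M) : deflate g f 0 = 0 := by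
  have hg0 : g 0 ≠ 0 := (toFun_zero_pos_iff.mp hg.2.2.2).ne'
  have h := hg.inner_eq_zero (M.sub_mem hf (M.smul_mem (f 0 / g 0) hg.1)) (by
    change f 0 - f 0 / g 0 * g 0 = 0
    rw [div_mul_cancel₀ _ hg0, sub_self])
  rw [inner_sub_right, inner_smul_right, real_inner_self_eq_norm_sq, hg.2.1, one_pow, mul_one,
    sub_eq_zero] at h
  change f 0 - ⟪g, f⟫_ℝ * g 0 = 0
  rw [h, div_mul_cancel₀ _ hg0, sub_self]

/-- The combination `g 0 • g' - g' 0 • g` vanishes at `0`, so it is orthogonal to both generators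
and hence to itself. -/
theorem IsNormalizedGenerator.eq {M : Submodule ℝ RealHardy} {g g' : RealHardy}
    (hg : IsNormalizedGenerator M g) (hg' : IsNormalizedGenerator M g') : g' = g := by
  have h1 := hg.inner_eq_zero (M.sub_mem (M.smul_mem (g 0) hg'.1) (M.smul_mem (g' 0) hg.1)) (by
    change g 0 * g' 0 - g' 0 * g 0 = 0
    ring)
  have h2 := hg'.inner_eq_zero (M.sub_mem (M.smul_mem (g 0) hg'.1) (M.smul_mem (g' 0) hg.1)) (by
    change g 0 * g' 0 - g' 0 * g 0 = 0
    ring)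
  have h3 : g 0 • g' = g' 0 • g := by
    rw [← sub_eq_zero, ← inner_self_eq_zero (𝕜 := ℝ)]
    nth_rewrite 1 [sub_eq_add_neg]
    rw [inner_add_left, inner_neg_left, inner_smul_left, inner_smul_left, h1, h2]
    simp
  have hp := toFun_zero_pos_iff.mp hg.2.2.2
  have hp' := toFun_zero_pos_iff.mp hg'.2.2.2
  have h4 := congrArg norm h3
  rw [norm_smul, norm_smul, hg.2.1, hg'.2.1, mul_one, mul_one, Real.norm_of_nonneg hp.le,
    Real.norm_of_nonneg hp'.le] at h4
  rw [← h4] at h3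
  exact smul_right_injective _ hp.ne' h3

theorem exists_isNormalizedGenerator {M : Submodule ℝ RealHardy}
    (hM : IsClosed (M : Set RealHardy)) (h : ∃ f ∈ M, toFun f 0 ≠ 0) :
    ∃ g, IsNormalizedGenerator M g := by
  obtain ⟨f, hf, hf0⟩ := h
  rw [Ne, toFun_zero_eq_zero_iff] at hf0
  set K := M ⊓ LinearMap.range shift.toLinearMap
  have hK : IsClosed (K : Set RealHardy) := hM.inter isClosed_range_shift
  have : CompleteSpace K := hK.completeSpace_coe
  obtain ⟨k, hk, v, hv, hkv⟩ := K.exists_add_mem_mem_orthogonal f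
  have hvM : v ∈ M := by
    rw [← add_sub_cancel_left k v, ← hkv]
    exact M.sub_mem hf hk.1
  have hk0 : k 0 = 0 := mem_range_shift_iff.mp hk.2
  have hv0 : v 0 ≠ 0 := by
    rw [hkv] at hf0
    change k 0 + v 0 ≠ 0 at hf0
    rwa [hk0, zero_add] at hf0
  have hvn : ‖v‖ ≠ 0 := by
    rw [norm_ne_zero_iff]
    rintro rfl
    exact hv0 rfl
  -- The factor `v 0 / |v 0|` is the sign of `v 0`; it makes the value at `0` positive.
  have hne : v 0 / |v 0| * ‖v‖⁻¹ * v 0 = |v 0| * ‖v‖⁻¹ := by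
    rw [div_mul_eq_mul_div, div_mul_eq_mul_div, div_eq_iff (abs_ne_zero.mpr hv0)]
    linear_combination (-‖v‖⁻¹) * abs_mul_abs_self (v 0)
  refine ⟨(v 0 / |v 0| * ‖v‖⁻¹) • v, M.smul_mem _ hvM, ?_, fun y hy => ?_, ?_⟩
  · rw [norm_smul, norm_mul, norm_div, norm_inv, norm_norm, Real.norm_eq_abs, Real.norm_eq_abs,
      abs_abs, div_self (abs_ne_zero.mpr hv0), one_mul, inv_mul_cancel₀ hvn]
  · rw [inner_smul_left, real_inner_comm, hv y hy, mul_zero]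
  · rw [toFun_zero_pos_iff]
    change 0 < v 0 / |v 0| * ‖v‖⁻¹ * v 0
    rw [hne]
    have := abs_pos.mpr hv0
    positivity

/-- Since `e ⟂ M`, the defect component of `backwardShift f` is `⟪e, backwardShift f⟫ = ⟪shift e,
f⟫`, so it can be removed before the backward shift instead of after. -/
theorem AdmitsDefect.deflate_backwardShift_mem {M : Submodule ℝ RealHardy} {e : RealHardy}
    (he : ‖e‖ = 1) (h : AdmitsDefect M (Submodule.span ℝ {e})) {f : RealHardy} (hf : f ∈ M)
    (hf0 : f 0 = 0) : backwardShift (deflate (shift e) f) ∈ M := by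
  obtain ⟨m, hm, y, hy, hmy⟩ := Submodule.mem_sup.mp
    (h.2.2 f hf (toFun_zero_eq_zero_iff.mpr hf0))
  obtain ⟨c, rfl⟩ := Submodule.mem_span_singleton.mp hy
  have hem : ⟪e, m⟫_ℝ = 0 := by
    rw [real_inner_comm]
    exact Submodule.isOrtho_iff_inner_eq.mp h.2.1 m hm e (Submodule.mem_span_singleton_self e)
  have hc : ⟪shift e, f⟫_ℝ = c := by
    rw [inner_shift_left, ← hmy, inner_add_right, hem, inner_smul_right,
      real_inner_self_eq_norm_sq, he]
    ring
  rw [deflate_apply, map_sub, map_smul, backwardShift_shift, hc, ← hmy, add_sub_cancel_right]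
  exact hm

end RealHardy

/-! ### The representation theorem. -/

open RealHardy in
theorem mainTheorem3 (M : Submodule ℝ RealHardy) (hMclosed : IsClosed (M : Set RealHardy))
    (hMne : M ≠ ⊥) (hMdefect : RealHardy.IsNearlyInvariantWithDefect M 1)
    (e : RealHardy) (he : ‖e‖ = 1)
    (hspan : RealHardy.IsDefectSpace M (Submodule.span ℝ {e})) :
    ((∃ f ∈ M, RealHardy.toFun f 0 ≠ 0) →
      (∃! g : RealHardy, RealHardy.IsNormalizedGenerator M g) ∧
      ∀ g : RealHardy, RealHardy.IsNormalizedGenerator M g →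
        ∃ N : Submodule ℝ (WithLp 2 (RealHardy × RealHardy)),
          IsClosed (N : Set (WithLp 2 (RealHardy × RealHardy))) ∧
          (∀ h h₁ : RealHardy, WithLp.toLp 2 (h, h₁) ∈ N →
            WithLp.toLp 2 (RealHardy.backwardShift h, RealHardy.backwardShift h₁) ∈ N) ∧
          RealHardy.toFun '' (M : Set RealHardy) =
            {F : 𝔻 → ℂ | ∃ h h₁ : RealHardy, WithLp.toLp 2 (h, h₁) ∈ N ∧
              F = fun z : 𝔻 => RealHardy.toFun g z * RealHardy.toFun h z +
                (z : ℂ) * RealHardy.toFun h₁ z * RealHardy.toFun e z} ∧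
          ∀ f ∈ M, ∀ h h₁ : RealHardy, WithLp.toLp 2 (h, h₁) ∈ N →
            (RealHardy.toFun f = fun z : 𝔻 => RealHardy.toFun g z * RealHardy.toFun h z +
                (z : ℂ) * RealHardy.toFun h₁ z * RealHardy.toFun e z) →
            ‖f‖ ^ 2 = ‖h‖ ^ 2 + ‖h₁‖ ^ 2) ∧
    ((∀ f ∈ M, RealHardy.toFun f 0 = 0) →
      ∃ N : Submodule ℝ RealHardy,
        IsClosed (N : Set RealHardy) ∧
        (∀ h₁ ∈ N, RealHardy.backwardShift h₁ ∈ N) ∧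
        RealHardy.toFun '' (M : Set RealHardy) =
          {F : 𝔻 → ℂ | ∃ h₁ ∈ N,
            F = fun z : 𝔻 => (z : ℂ) * RealHardy.toFun h₁ z * RealHardy.toFun e z} ∧
        ∀ f ∈ M, ∀ h₁ ∈ N,
          (RealHardy.toFun f =
            fun z : 𝔻 => (z : ℂ) * RealHardy.toFun h₁ z * RealHardy.toFun e z) →
          ‖f‖ = ‖h₁‖) := by
  have hq : ‖shift e‖ = 1 := (norm_shift e).trans he
  have : CompleteSpace M := hMclosed.completeSpace_coe
  refine ⟨fun hex => ⟨?_, fun g hg => ?_⟩, fun hvan => ?_⟩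
  · obtain ⟨g, hg⟩ := exists_isNormalizedGenerator hMclosed hex
    exact ⟨g, hg, fun g' hg' => hg.eq hg'⟩
  · have hM : ∀ f ∈ M, deflate (shift e) (deflate g f) 0 = 0 := fun f hf => by
      change deflate g f 0 - _ * shift e 0 = 0
      rw [hg.deflate_apply_zero hf, shift_apply_zero, mul_zero, sub_zero]
    have hA : ∀ f ∈ M, deflatedShift g (shift e) f ∈ M := fun f hf =>
      hspan.1.deflate_backwardShift_mem he (M.sub_mem hf (M.smul_mem _ hg.1))
        (hg.deflate_apply_zero hf)
    have hfun : ∀ f ∈ M, toFun f = fun z : 𝔻 =>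
        toFun g z * toFun (fstCoeff hg.2.1 hq f) z +
          (z : ℂ) * toFun (sndCoeff hg.2.1 hq f) z * toFun e z := fun f hf => by
      funext z
      rw [toFun_eq_mul_fstCoeff_add_mul_sndCoeff hg.2.1 hq hA hM hf z, toFun_shift]
      ring
    -- As an isometry on the complete space `M`, this map has closed range.
    let J : M →ₗᵢ[ℝ] WithLp 2 (RealHardy × RealHardy) :=
      { toLinearMap := (WithLp.linearEquiv 2 ℝ (RealHardy × RealHardy)).symm.toLinearMap ∘ₗ
          ((fstCoeff hg.2.1 hq).prod (sndCoeff hg.2.1 hq)) ∘ₗ M.subtype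
        norm_map' := fun f => by
          rw [← sq_eq_sq₀ (norm_nonneg _) (norm_nonneg _), WithLp.prod_norm_sq_eq_of_L2]
          exact (norm_sq_eq_fstCoeff_add_sndCoeff hg.2.1 hq hA hM f.2).symm }
    have hJ : ∀ {h h₁ : RealHardy}, WithLp.toLp 2 (h, h₁) ∈ LinearMap.range J.toLinearMap ↔
        ∃ f ∈ M, fstCoeff hg.2.1 hq f = h ∧ sndCoeff hg.2.1 hq f = h₁ := by
      intro h h₁
      constructor
      · rintro ⟨f, hf⟩
        have hf' := congrArg WithLp.ofLp hf
        exact ⟨f, f.2, congrArg Prod.fst hf', congrArg Prod.snd hf'⟩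
      · rintro ⟨f, hf, rfl, rfl⟩
        exact ⟨⟨f, hf⟩, rfl⟩
    refine ⟨LinearMap.range J.toLinearMap, J.isometry.isClosedEmbedding.isClosed_range,
      fun h h₁ hh => ?_, ?_, fun f hf h h₁ hh hfh => ?_⟩
    · obtain ⟨f, hf, rfl, rfl⟩ := hJ.mp hh
      exact hJ.mpr ⟨_, hA f hf, fstCoeff_deflatedShift _ _ f, sndCoeff_deflatedShift _ _ f⟩
    · ext F
      constructor
      · rintro ⟨f, hf, rfl⟩
        exact ⟨_, _, hJ.mpr ⟨f, hf, rfl, rfl⟩, hfun f hf⟩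
      · rintro ⟨h, h₁, hh, rfl⟩
        obtain ⟨f, hf, rfl, rfl⟩ := hJ.mp hh
        exact ⟨f, hf, hfun f hf⟩
    · obtain ⟨f', hf', rfl, rfl⟩ := hJ.mp hh
      -- A pair in `N` comes from some `f' ∈ M` that it represents, so equality of functions
      -- identifies `f'` with `f`.
      obtain rfl : f = f' := toFun_injective (hfh.trans (hfun f' hf').symm)
      exact norm_sq_eq_fstCoeff_add_sndCoeff hg.2.1 hq hA hM hf
  · have hvan' : ∀ f ∈ M, f 0 = 0 := fun f hf => toFun_zero_eq_zero_iff.mp (hvan f hf)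
    -- With `g = q = shift e` the second deflation does nothing, so the second coefficient function
    -- is zero and a single factor remains.
    have hidem : ∀ f, deflate (shift e) (deflate (shift e) f) = deflate (shift e) f := fun f => by
      rw [deflate_apply _ (deflate (shift e) f), deflate_apply, inner_sub_right, inner_smul_right,
        real_inner_self_eq_norm_sq, hq, one_pow, mul_one, sub_self, zero_smul, sub_zero]
    have hM : ∀ f ∈ M, deflate (shift e) (deflate (shift e) f) 0 = 0 := fun f hf => by
      rw [hidem]
      change f 0 - _ * shift e 0 = 0
      rw [hvan' f hf, shift_apply_zero, mul_zero, sub_zero]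
    have hA : ∀ f ∈ M, deflatedShift (shift e) (shift e) f ∈ M := fun f hf => by
      change backwardShift (deflate (shift e) (deflate (shift e) f)) ∈ M
      rw [hidem]
      exact hspan.1.deflate_backwardShift_mem he hf (hvan' f hf)
    have hsnd : ∀ f, sndCoeff hq hq f = 0 := fun f => by
      ext n
      rw [sndCoeff_apply, deflate_apply, inner_sub_right, inner_smul_right,
        real_inner_self_eq_norm_sq, hq, one_pow, mul_one, sub_self]
      rfl
    have hnorm : ∀ f ∈ M, ‖f‖ = ‖fstCoeff hq hq f‖ := fun f hf => by
      rw [← sq_eq_sq₀ (norm_nonneg _) (norm_nonneg _),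
        norm_sq_eq_fstCoeff_add_sndCoeff hq hq hA hM hf, hsnd, norm_zero]
      ring
    have hfun : ∀ f ∈ M, toFun f = fun z : 𝔻 =>
        (z : ℂ) * toFun (fstCoeff hq hq f) z * toFun e z := fun f hf => by
      funext z
      have h0 : toFun 0 z = 0 := by simpa using toFun_smul 0 0 z
      rw [toFun_eq_mul_fstCoeff_add_mul_sndCoeff hq hq hA hM hf z, toFun_shift, hsnd, h0]
      ring
    let J : M →ₗᵢ[ℝ] RealHardy :=
      { toLinearMap := fstCoeff hq hq ∘ₗ M.subtype
        norm_map' := fun f => (hnorm f f.2).symm }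
    refine ⟨LinearMap.range J.toLinearMap, J.isometry.isClosedEmbedding.isClosed_range,
      ?_, ?_, ?_⟩
    · rintro _ ⟨f, rfl⟩
      exact ⟨⟨_, hA f f.2⟩, fstCoeff_deflatedShift hq hq f⟩
    · ext F
      constructor
      · rintro ⟨f, hf, rfl⟩
        exact ⟨_, ⟨⟨f, hf⟩, rfl⟩, hfun f hf⟩
      · rintro ⟨_, ⟨f, rfl⟩, rfl⟩
        exact ⟨f, f.2, hfun f f.2⟩
    · rintro f hf _ ⟨f', rfl⟩ hff
      have hff' : f = f' := toFun_injective (hff.trans (hfun f' f'.2).symm)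
      rw [hff']
      exact hnorm f' f'.2
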